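/- Let $A$ be a C*-algebra, and let $I$ and $J$ be closed two-sided ideals of $A$, each of which is $\sigma$-unital (that is, has a countable approximate unit). Let $H$ be a countably generated right Hilbert C*-module over $A$. For a closed two-sided ideal $K$ of $A$ let $HK=\{h\cdot k : h\in H,\ k\in K\}$, which is a closed submodule of $H$ and is regarded as a Hilbert C*-module over $A$ with the $A$-valued inner product of $H$. Then there is an isomorphism of Hilbert C*-modules over $A$ (a bijective $A$-linear map preserving the $A$-valued inner products) \[HI\oplus HJ\;\cong\; H(I+J)\oplus H(I\cap J),\] where direct sums carry the inner product $\langle (x,y),(x',y')\rangle=\langle x,x'\rangle+\langle y,y'\rangle$. -/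

import Mathlib

open scoped InnerProductSpace RightActions WithCStarModule Topology
open Filter MulOpposite

/-!
Right Hilbert C⋆-modules over `A` are expressed through Mathlib's class `CStarModule`: its scalar
action satisfies `⟪x, c • y⟫ = c * ⟪x, y⟫`, so a *right* Hilbert `A`-module is a
`CStarModule Aᵐᵒᵖ H`, with `h <• a = op a • h` the right action of `a : A` on `h : H`, and
`⟪x, y <• a⟫ = op (unop ⟪x, y⟫ * a)`.
-/

namespace RightHilbert

section Basic

variable {B H : Type*} [NonUnitalCStarAlgebra B] [PartialOrder B]
  [NormedAddCommGroup H] [NormedSpace ℂ H] [SMul B H] [CStarModule B H]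

theorem ext_inner {x y : H} (h : ∀ z : H, ⟪z, x⟫_B = ⟪z, y⟫_B) : x = y := by
  have h0 : ⟪x - y, x - y⟫_B = 0 := by
    rw [CStarModule.inner_sub_right, h, sub_self]
  exact sub_eq_zero.mp (CStarModule.inner_self.mp h0)

theorem smul_add' (c : B) (x y : H) : c • (x + y) = c • x + c • y :=
  ext_inner (B := B) fun z => by simp [mul_add]

theorem smul_smul_comm' (c : B) (r : ℂ) (x : H) : c • (r • x) = r • (c • x) :=
  ext_inner (B := B) fun z => by simp [mul_smul_comm]

theorem mul_smul' (c d : B) (x : H) : (c * d) • x = c • (d • x) :=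
  ext_inner (B := B) fun z => by simp [mul_assoc]

theorem sub_smul' (c d : B) (x : H) : (c - d) • x = c • x - d • x :=
  ext_inner (B := B) fun z => by simp [sub_mul]

theorem norm_smul_sq (c : B) (x : H) : ‖c • x‖ ^ 2 = ‖c * ⟪x, x⟫_B * star c‖ := by
  rw [CStarModule.norm_sq_eq B]
  simp [mul_assoc]

theorem norm_smul_le' (c : B) (x : H) : ‖c • x‖ ≤ ‖c‖ * ‖x‖ := by
  refine (sq_le_sq₀ (norm_nonneg _) (by positivity)).mp ?_
  rw [norm_smul_sq]
  calc _ ≤ ‖c‖ * ‖⟪x, x⟫_B‖ * ‖star c‖ := (norm_mul_le _ _).trans (by gcongr; exact norm_mul_le _ _)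
    _ = _ := by rw [norm_star, ← CStarModule.norm_sq_eq B]; ring

/-- The action of a fixed element of the algebra, as a bounded operator. -/
noncomputable def smulL (c : B) : H →L[ℂ] H :=
  LinearMap.mkContinuous
    { toFun := fun x => c • x
      map_add' := smul_add' c
      map_smul' := smul_smul_comm' c } ‖c‖ (norm_smul_le' c)

@[simp] theorem smulL_apply (c : B) (x : H) : smulL c x = c • x := rfl

variable [StarOrderedRing B]

theorem norm_cfc_smul_le {b : B} (hb : 0 ≤ b) {x : H} (hx : ⟪x, x⟫_B = cfcₙ (fun s : ℝ => s ^ 4) b)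
    {f : ℝ → ℝ} (hf : Continuous f) (hf0 : f 0 = 0) {C : ℝ} (hC : 0 ≤ C)
    (hfC : ∀ s, 0 ≤ s → s ^ 2 * |f s| ≤ C) : ‖cfcₙ f b • x‖ ≤ C := by
  refine (sq_le_sq₀ (norm_nonneg _) hC).mp ?_
  rw [norm_smul_sq, hx, ← cfcₙ_star,
    ← cfcₙ_mul f _ b hf.continuousOn hf0 (by fun_prop) (by simp),
    ← cfcₙ_mul _ _ b (by fun_prop) (by simp [hf0]) (by fun_prop) (by simp [hf0])]
  refine norm_cfcₙ_le fun s hs => ?_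
  have h0 : 0 ≤ s := quasispectrum_nonneg_of_nonneg b hb s hs
  have h1 := hfC s h0
  have h2 : ‖f s * s ^ 4 * star (f s)‖ = (s ^ 2 * |f s|) ^ 2 := by
    simp only [star_trivial, norm_mul, norm_pow, Real.norm_eq_abs, abs_of_nonneg h0]
    ring
  rw [h2]
  gcongr

/-- Every element `x` of a Hilbert C⋆-module is a product `b • y` where `b` belongs to the closed
one-sided ideal generated by `⟪x, x⟫`. -/
theorem exists_factor [CompleteSpace H] (x : H) : ∃ (b : B) (y : H),
    b ∈ closure (Set.range fun c : B => ⟪x, x⟫_B * c) ∧ b • y = x := by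
  set a : B := ⟪x, x⟫_B with ha
  have ha0 : 0 ≤ a := CStarModule.inner_self_nonneg
  set b : B := CFC.sqrt (CFC.sqrt a) with hbdef
  have hb : 0 ≤ b := CFC.sqrt_nonneg _
  have hbs : IsSelfAdjoint b := hb.isSelfAdjoint
  have hab : a = cfcₙ (fun s : ℝ => s ^ 4) b := by
    have h1 : a = (b * b) * (b * b) := by
      rw [hbdef, CFC.sqrt_mul_sqrt_self _ (CFC.sqrt_nonneg _), CFC.sqrt_mul_sqrt_self _ ha0]
    have h2 : b * b = cfcₙ (fun s : ℝ => s * s) b := by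
      rw [cfcₙ_mul (fun s : ℝ => s) (fun s : ℝ => s) b, cfcₙ_id' ℝ b]
    rw [h1, h2, ← cfcₙ_mul _ _ b (by fun_prop) (by simp) (by fun_prop) (by simp)]
    congr 1
    ext s
    ring
  let d : ℕ → ℝ := fun n => 1 / ((n : ℝ) + 1)
  have hd : ∀ n, 0 < d n := fun n => Nat.one_div_pos_of_nat
  have hdlim : Tendsto d atTop (𝓝 0) := tendsto_one_div_add_atTop_nhds_zero_nat
  have hden : ∀ n (s : ℝ), 0 < s ^ 4 + d n ^ 4 := fun n s => by
    have := hd n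
    positivity
  have hq : ∀ k n, Continuous fun s : ℝ => s ^ k / (s ^ 4 + d n ^ 4) := fun k n =>
    (by fun_prop : Continuous fun s : ℝ => s ^ k).div (by fun_prop) fun s => (hden n s).ne'
  have key : ∀ n (s : ℝ), 0 ≤ s → |s - s ^ 5 / (s ^ 4 + d n ^ 4)| ≤ d n := by
    intro n s hs
    have hdn := hd n
    have h1 : s - s ^ 5 / (s ^ 4 + d n ^ 4) = s * d n ^ 4 / (s ^ 4 + d n ^ 4) := by
      field_simp [(hden n s).ne']
      ring
    rw [h1, abs_of_nonneg (by have := hden n s; positivity), div_le_iff₀ (hden n s)]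
    rcases le_total s (d n) with h | h
    · have : s * d n ^ 4 ≤ d n * d n ^ 4 := by gcongr
      have : 0 ≤ d n * s ^ 4 := by positivity
      nlinarith
    · have : s * d n ^ 3 ≤ s * s ^ 3 := by gcongr
      nlinarith [pow_pos hdn 5]
  -- the approximations of the second factor
  let f : ℕ → ℝ → ℝ := fun n s => s ^ 3 / (s ^ 4 + d n ^ 4)
  have hf : ∀ n, Continuous (f n) := fun n => hq 3 n
  have hf0 : ∀ n, f n 0 = 0 := fun n => by simp [f]
  let y : ℕ → H := fun n => cfcₙ (f n) b • x
  have hy : ∀ n m, ‖y n - y m‖ ≤ d n + d m := by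
    intro n m
    have h1 : y n - y m = cfcₙ (fun s => f n s - f m s) b • x := by
      rw [cfcₙ_sub (f n) (f m) b (hf n).continuousOn (hf0 n) (hf m).continuousOn (hf0 m), sub_smul']
    rw [h1]
    refine norm_cfc_smul_le hb hab ((hf n).sub (hf m)) (by simp [hf0])
      (add_nonneg (hd n).le (hd m).le) fun s hs => ?_
    have h2 : s ^ 2 * |f n s - f m s| =
        |(s - s ^ 5 / (s ^ 4 + d m ^ 4)) - (s - s ^ 5 / (s ^ 4 + d n ^ 4))| := by
      rw [← abs_of_nonneg (sq_nonneg s), ← abs_mul]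
      congr 1
      simp only [f]
      ring
    change s ^ 2 * |f n s - f m s| ≤ d n + d m
    rw [h2, add_comm (d n)]
    exact (abs_sub _ _).trans (add_le_add (key m s hs) (key n s hs))
  have hcau : CauchySeq y := by
    rw [Metric.cauchySeq_iff']
    intro e he
    obtain ⟨N, hN⟩ := (hdlim.eventually (gt_mem_nhds (half_pos he))).exists_forall_of_atTop
    refine ⟨N, fun n hn => ?_⟩
    rw [dist_eq_norm]
    linarith [hy n N, hN n hn, hN N le_rfl]
  obtain ⟨z, hz⟩ := cauchySeq_tendsto_of_complete hcau
  refine ⟨b, z, ?_, ?_⟩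
  · refine mem_closure_of_tendsto (f := fun n => a * cfcₙ (fun s : ℝ => s ^ 1 / (s ^ 4 + d n ^ 4)) b)
      (b := atTop) ?_ (Eventually.of_forall fun n => ⟨_, rfl⟩)
    rw [tendsto_iff_norm_sub_tendsto_zero]
    refine squeeze_zero (fun _ => norm_nonneg _) (fun n => ?_) hdlim
    have h1 : a * cfcₙ (fun s : ℝ => s ^ 1 / (s ^ 4 + d n ^ 4)) b - b =
        cfcₙ (fun s : ℝ => s ^ 4 * (s ^ 1 / (s ^ 4 + d n ^ 4)) - s) b := by
      rw [cfcₙ_sub (fun s : ℝ => s ^ 4 * (s ^ 1 / (s ^ 4 + d n ^ 4))) (fun s => s) b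
        ((by fun_prop : Continuous fun s : ℝ => s ^ 4).mul (hq 1 n)).continuousOn
        (by simp) (by fun_prop) rfl,
        cfcₙ_mul _ _ b (by fun_prop) (by simp) (hq 1 n).continuousOn (by simp), ← hab,
        cfcₙ_id' ℝ b]
    rw [h1]
    refine norm_cfcₙ_le fun s hs => ?_
    have h2 := key n s (quasispectrum_nonneg_of_nonneg b hb s hs)
    rw [abs_sub_comm] at h2
    have h3 : s ^ 4 * (s ^ 1 / (s ^ 4 + d n ^ 4)) - s = s ^ 5 / (s ^ 4 + d n ^ 4) - s := by ring
    rw [h3, Real.norm_eq_abs]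
    exact h2
  · have hlim : Tendsto (fun n => b • y n) atTop (𝓝 (b • z)) :=
      ((smulL b : H →L[ℂ] H).continuous.tendsto z).comp hz
    refine tendsto_nhds_unique hlim ?_
    rw [tendsto_iff_norm_sub_tendsto_zero]
    refine squeeze_zero (fun _ => norm_nonneg _) (fun n => ?_)
      (by simpa using hdlim.pow 2 : Tendsto (fun n => d n ^ 2) atTop (𝓝 0))
    let g : ℝ → ℝ := fun s => s ^ 4 / (s ^ 4 + d n ^ 4)
    have hg : Continuous g := hq 4 n
    have hg0 : g 0 = 0 := by simp [g]
    have hbf : b * cfcₙ (f n) b = cfcₙ g b := by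
      have h1 : cfcₙ (fun s : ℝ => s * f n s) b = b * cfcₙ (f n) b := by
        rw [cfcₙ_mul (fun s : ℝ => s) (f n) b (by fun_prop) rfl (hf n).continuousOn (hf0 n),
          cfcₙ_id' ℝ b]
      rw [← h1]
      congr 1
      ext s
      simp only [f, g]
      ring
    have hgs : star (cfcₙ g b) = cfcₙ g b := by simp [← cfcₙ_star]
    have h1 : b • y n = cfcₙ g b • x := by
      rw [← hbf, mul_smul']
    refine (sq_le_sq₀ (norm_nonneg _) (by positivity)).mp ?_
    rw [h1, CStarModule.norm_sq_eq B]
    have hga : cfcₙ g b * a = cfcₙ (fun s => g s * s ^ 4) b := by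
      rw [cfcₙ_mul g _ b hg.continuousOn hg0 (by fun_prop) (by simp), ← hab]
    have hag : a * cfcₙ g b = cfcₙ (fun s => s ^ 4 * g s) b := by
      rw [cfcₙ_mul _ g b (by fun_prop) (by simp) hg.continuousOn hg0, ← hab]
    have hgag : cfcₙ g b * a * cfcₙ g b = cfcₙ (fun s => g s * s ^ 4 * g s) b := by
      rw [hga, ← cfcₙ_mul _ g b (by fun_prop) (by simp [hg0]) hg.continuousOn hg0]
    have h2 : ⟪cfcₙ g b • x - x, cfcₙ g b • x - x⟫_B =
        cfcₙ (fun s => (g s * s ^ 4 * g s - s ^ 4 * g s) - (g s * s ^ 4 - s ^ 4)) b := by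
      rw [cfcₙ_sub (fun s => g s * s ^ 4 * g s - s ^ 4 * g s) (fun s => g s * s ^ 4 - s ^ 4) b
          (by fun_prop) (by simp [hg0]) (by fun_prop) (by simp [hg0]),
        cfcₙ_sub (fun s => g s * s ^ 4 * g s) (fun s => s ^ 4 * g s) b
          (by fun_prop) (by simp [hg0]) (by fun_prop) (by simp [hg0]),
        cfcₙ_sub (fun s => g s * s ^ 4) (fun s => s ^ 4) b
          (by fun_prop) (by simp [hg0]) (by fun_prop) (by simp),
        ← hga, ← hag, ← hgag, ← hab]
      simp only [CStarModule.inner_sub_left, CStarModule.inner_sub_right,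
        CStarModule.inner_op_smul_left, CStarModule.inner_op_smul_right, hgs, ← ha]
      noncomm_ring
    rw [h2]
    refine norm_cfcₙ_le fun s hs => ?_
    have hp := hden n s
    have h3 : (g s * s ^ 4 * g s - s ^ 4 * g s) - (g s * s ^ 4 - s ^ 4) =
        (s ^ 2 * d n ^ 4 / (s ^ 4 + d n ^ 4)) ^ 2 := by
      simp only [g]
      field_simp
      ring
    rw [h3, norm_pow, Real.norm_eq_abs, abs_of_nonneg (by positivity)]
    gcongr
    rw [div_le_iff₀ hp]
    have h4 : 0 ≤ d n ^ 2 * ((s ^ 2 - d n ^ 2) ^ 2 + s ^ 2 * d n ^ 2) := by positivity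
    nlinarith

end Basic

section Ideal

variable {A : Type*} [NonUnitalCStarAlgebra A] [PartialOrder A]
variable (H : Type*) [NormedAddCommGroup H] [NormedSpace ℂ H] [SMul Aᵐᵒᵖ H] [CStarModule Aᵐᵒᵖ H]

/-- The right Hilbert `A`-module `H` is countably generated: for some sequence of elements `g n`,
the elements `g n <• a`, `a : A`, have dense linear span. -/
def CountablyGenerated : Prop :=
  ∃ g : ℕ → H, Dense (Submodule.span ℂ {x : H | ∃ (n : ℕ) (a : A), x = g n <• a} : Set H)

/-- The submodule `HI` of `H`: the closed linear span of the products `h <• i` with `h : H` and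
`i ∈ I`. For a closed ideal `I` it is the set of these products, see `mem_idealSubmodule_iff`. -/
def idealSubmodule (I : TwoSidedIdeal A) : Submodule ℂ H :=
  (Submodule.span ℂ {x : H | ∃ h : H, ∃ i ∈ I, x = h <• i}).topologicalClosure

variable {H}

theorem smul_mem_idealSubmodule (I : TwoSidedIdeal A) (c : Aᵐᵒᵖ) {x : H}
    (hx : x ∈ idealSubmodule H I) : c • x ∈ idealSubmodule H I := by
  refine map_mem_closure (smulL c).continuous hx fun y hy => ?_
  have hle : Submodule.span ℂ {x : H | ∃ h : H, ∃ i ∈ I, x = h <• i} ≤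
      (Submodule.span ℂ {x : H | ∃ h : H, ∃ i ∈ I, x = h <• i}).comap
        (smulL c : H →L[ℂ] H).toLinearMap := by
    rw [Submodule.span_le]
    rintro _ ⟨h, i, hi, rfl⟩
    refine Submodule.subset_span ⟨h, i * unop c, I.mul_mem_right _ _ hi, ?_⟩
    simp [mul_smul']
  exact hle hy

instance (I : TwoSidedIdeal A) : SMul Aᵐᵒᵖ (idealSubmodule H I) where
  smul c x := ⟨c • (x : H), smul_mem_idealSubmodule I c x.2⟩

/-- `HI` is a Hilbert `A`-module with the inner product of `H`. -/
instance (I : TwoSidedIdeal A) : CStarModule Aᵐᵒᵖ (idealSubmodule H I) where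
  inner x y := ⟪(x : H), (y : H)⟫_(Aᵐᵒᵖ)
  inner_add_right := CStarModule.inner_add_right
  inner_self_nonneg := CStarModule.inner_self_nonneg
  inner_self := CStarModule.inner_self.trans Submodule.coe_eq_zero
  inner_op_smul_right := CStarModule.inner_op_smul_right
  inner_smul_right_complex := CStarModule.inner_smul_right_complex
  star_inner x y := CStarModule.star_inner (x : H) (y : H)
  norm_eq_sqrt_norm_inner_self x := CStarModule.norm_eq_sqrt_norm_inner_self (x : H)

theorem coe_smul_idealSubmodule (I : TwoSidedIdeal A) (c : Aᵐᵒᵖ) (x : idealSubmodule H I) :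
    ((c • x : idealSubmodule H I) : H) = c • (x : H) := rfl

theorem inner_idealSubmodule (I : TwoSidedIdeal A) (x y : idealSubmodule H I) :
    ⟪x, y⟫_(Aᵐᵒᵖ) = ⟪(x : H), (y : H)⟫_(Aᵐᵒᵖ) := rfl

variable [StarOrderedRing A]

theorem inner_mem_of_mem {I : TwoSidedIdeal A} (hI : IsClosed (I : Set A)) {x : H}
    (hx : x ∈ idealSubmodule H I) (z : H) : unop ⟪z, x⟫_(Aᵐᵒᵖ) ∈ I := by
  have hcont : Continuous fun y : H => unop ⟪z, y⟫_(Aᵐᵒᵖ) :=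
    continuous_unop.comp (CStarModule.innerSL (A := Aᵐᵒᵖ) z).continuous
  have hcl : IsClosed {y : H | unop ⟪z, y⟫_(Aᵐᵒᵖ) ∈ I} := hI.preimage hcont
  refine closure_minimal ?_ hcl hx
  intro y hy
  induction hy using Submodule.closure_induction with
  | zero => simp [I.zero_mem]
  | add y w _ _ h1 h2 => simpa using I.add_mem h1 h2
  | smul_mem r y hy =>
    obtain ⟨h, i, hi, rfl⟩ := hy
    rw [← smul_smul_comm' (B := Aᵐᵒᵖ), Set.mem_ofPred_eq, CStarModule.inner_op_smul_right]
    exact I.mul_mem_left _ _ hi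

/-- For a closed two-sided ideal `I`, the elements of `HI` are exactly the products `h <• i`. -/
theorem mem_idealSubmodule_iff [CompleteSpace H] {I : TwoSidedIdeal A} (hI : IsClosed (I : Set A))
    {x : H} : x ∈ idealSubmodule H I ↔ ∃ h : H, ∃ i ∈ I, x = h <• i := by
  constructor
  · intro hx
    obtain ⟨b, y, hb, hy⟩ := exists_factor (B := Aᵐᵒᵖ) x
    refine ⟨y, unop b, ?_, by simpa using hy.symm⟩
    have hcl : IsClosed {c : Aᵐᵒᵖ | unop c ∈ I} := hI.preimage continuous_unop
    refine closure_minimal ?_ hcl hb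
    rintro _ ⟨c, rfl⟩
    exact I.mul_mem_left _ _ (inner_mem_of_mem hI hx x)
  · rintro ⟨h, i, hi, rfl⟩
    exact Submodule.le_topologicalClosure _ (Submodule.subset_span ⟨h, i, hi, rfl⟩)

/-- A two-sided ideal of `A` is `σ`-unital if it has a countable approximate unit: a sequence of
positive contractions in the ideal that is an approximate unit for it. -/
def IsSigmaUnital (I : TwoSidedIdeal A) : Prop :=
  ∃ u : ℕ → A, (∀ n, u n ∈ I ∧ 0 ≤ u n ∧ ‖u n‖ ≤ 1) ∧
    ∀ x ∈ I, Tendsto (fun n => u n * x) atTop (𝓝 x) ∧ Tendsto (fun n => x * u n) atTop (𝓝 x)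

end Ideal

section Iso

variable (A : Type*) [NonUnitalCStarAlgebra A] [PartialOrder A] [StarOrderedRing A]
variable (E F : Type*) [NormedAddCommGroup E] [NormedSpace ℂ E] [SMul Aᵐᵒᵖ E] [CStarModule Aᵐᵒᵖ E]
  [NormedAddCommGroup F] [NormedSpace ℂ F] [SMul Aᵐᵒᵖ F] [CStarModule Aᵐᵒᵖ F]

/-- Isomorphism of right Hilbert `A`-modules: a bijective `A`-linear map that preserves the
`A`-valued inner products. -/
def Isomorphic : Prop :=
  ∃ U : E ≃ₗ[ℂ] F, (∀ (x : E) (a : A), U (x <• a) = U x <• a) ∧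
    ∀ x y : E, ⟪U x, U y⟫_(Aᵐᵒᵖ) = ⟪x, y⟫_(Aᵐᵒᵖ)

end Iso

end RightHilbert

/-! Write `HS` and `HL` for the submodules of `I ⊔ J` and `I ⊓ J`. By the polar decomposition
(`IsAdjointPair.exists_equiv`) it suffices to find an adjointable map HI ⊕ HJ → HS ⊕ HL which,
together with its adjoint, has dense range. Countable generation and σ-unitality give generating
sequences of HI and HJ; weighted sums of their rank one operators are positive operators `a` and `b`
on `H` with ranges in HI and HJ (`exists_operator`). The map is T(x, y) = (ax + by, ay - bx), and
its adjoint is the same matrix with `-b` for `b`. Since `a` maps HJ, and `b` maps HI, into HI ∩ HJ =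
HL, both maps land where they should. For density, T acts on the vectors (v, ±iv) with v in HL as a
± ib. These operators are accretive with real part `a`, and a resolvent estimate
(`IsAccretive.exists_approx`) shows that each maps HL onto a dense subset of HL. Hence HL ⊕ HL lies
in the closed range of T (`prod_mem_rotationRange`), and likewise for the adjoint. Modulo HL ⊕ HL
the mixed terms disappear, and what remains is that `a` and `b` have dense range in HI and HJ. -/

namespace RightHilbert

/-! ### Adjoint pairs of maps -/

section AdjointPair

variable {B E F G : Type*} [NonUnitalCStarAlgebra B] [PartialOrder B]
  [NormedAddCommGroup E] [NormedSpace ℂ E] [SMul B E] [CStarModule B E]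
  [NormedAddCommGroup F] [NormedSpace ℂ F] [SMul B F] [CStarModule B F]

variable (B) in
/-- The maps `S` and `T` between Hilbert C⋆-modules are adjoint to each other. -/
def IsAdjointPair (S : E → F) (T : F → E) : Prop :=
  ∀ x y, ⟪S x, y⟫_B = ⟪x, T y⟫_B

theorem IsAdjointPair.symm {S : E → F} {T : F → E} (h : IsAdjointPair B S T) :
    IsAdjointPair B T S := fun x y => by
  rw [← CStarModule.star_inner, ← h, CStarModule.star_inner]

theorem IsAdjointPair.unique {S : E → F} {T T' : F → E} (h : IsAdjointPair B S T)
    (h' : IsAdjointPair B S T') : T = T' :=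
  funext fun y => ext_inner (B := B) fun z => by rw [← h, ← h']

theorem IsAdjointPair.map_smul {S : E → F} {T : F → E} (h : IsAdjointPair B S T) (c : B) (x : E) :
    S (c • x) = c • S x :=
  ext_inner (B := B) fun z => by simp [← h.symm z]

/-- Closed graph theorem: if uₙ → x and S uₙ → y, then ⟪z, S uₙ⟫ = ⟪T z, uₙ⟫ forces ⟪z, y⟫ = ⟪z, S
x⟫ for all z. -/
theorem IsAdjointPair.continuous [StarOrderedRing B] [CompleteSpace E] [CompleteSpace F]
    {S : E →ₗ[ℂ] F} {T : F → E} (h : IsAdjointPair B S T) : Continuous S := by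
  refine S.continuous_of_seq_closed_graph fun u x y hu hSu => ext_inner (B := B) fun z => ?_
  rw [← h.symm z]
  refine tendsto_nhds_unique (((CStarModule.innerSL (A := B) z).continuous.tendsto y).comp hSu) ?_
  refine (((CStarModule.innerSL (A := B) (T z)).continuous.tendsto x).comp hu).congr fun n => ?_
  exact h.symm z (u n)

end AdjointPair

/-! ### The C⋆-algebra of adjointable operators -/

section Adjointable

variable (B E : Type*) [NonUnitalCStarAlgebra B] [PartialOrder B]
  [NormedAddCommGroup E] [NormedSpace ℂ E] [SMul B E] [CStarModule B E]

/-- The algebra of bounded operators on a Hilbert C⋆-module that have a bounded adjoint. -/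
def Adjointable : Subalgebra ℂ (E →L[ℂ] E) where
  carrier := {S | ∃ T : E →L[ℂ] E, IsAdjointPair B S T}
  mul_mem' := by
    rintro S S' ⟨T, h⟩ ⟨T', h'⟩
    exact ⟨T' * T, fun x y => (h (S' x) y).trans (h' x (T y))⟩
  add_mem' := by
    rintro S S' ⟨T, h⟩ ⟨T', h'⟩
    exact ⟨T + T', fun x y => by simp [h x y, h' x y]⟩
  algebraMap_mem' r := ⟨algebraMap ℂ _ (star r), fun x y => by
    simp [Algebra.algebraMap_eq_smul_one]⟩

namespace Adjointable

variable {B E}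

noncomputable instance : Star (Adjointable B E) where
  star S := ⟨S.2.choose, S, S.2.choose_spec.symm⟩

theorem isAdjointPair_star (S : Adjointable B E) :
    IsAdjointPair B (S : E →L[ℂ] E) (star S : Adjointable B E).1 := S.2.choose_spec

theorem inner_left (S : Adjointable B E) (x y : E) :
    ⟪S.1 x, y⟫_B = ⟪x, (star S).1 y⟫_B := (isAdjointPair_star S) x y

theorem inner_right (S : Adjointable B E) (x y : E) :
    ⟪x, S.1 y⟫_B = ⟪(star S).1 x, y⟫_B := ((isAdjointPair_star S).symm x y).symm

theorem ext_of_inner {S T : Adjointable B E} (h : ∀ x y, ⟪x, S.1 y⟫_B = ⟪x, T.1 y⟫_B) : S = T :=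
  Subtype.ext <| ContinuousLinearMap.ext fun y => ext_inner (B := B) fun x => h x y

theorem star_eq_of_isAdjointPair {S T : Adjointable B E} (h : IsAdjointPair B S.1 T.1) :
    star S = T :=
  ext_of_inner fun x y => by rw [← inner_left, h]

noncomputable instance : StarRing (Adjointable B E) where
  star_involutive S := star_eq_of_isAdjointPair (isAdjointPair_star S).symm
  star_mul S T := star_eq_of_isAdjointPair fun x y => by
    change ⟪S.1 (T.1 x), y⟫_B = ⟪x, (star T).1 ((star S).1 y)⟫_B
    rw [inner_left, inner_left]
  star_add S T := star_eq_of_isAdjointPair fun x y => by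
    change ⟪S.1 x + T.1 x, y⟫_B = ⟪x, (star S).1 y + (star T).1 y⟫_B
    simp [inner_left]

noncomputable instance : StarModule ℂ (Adjointable B E) where
  star_smul r S := star_eq_of_isAdjointPair fun x y => by
    change ⟪r • S.1 x, y⟫_B = ⟪x, star r • (star S).1 y⟫_B
    simp [inner_left]

theorem map_smul (S : Adjointable B E) (c : B) (x : E) : S.1 (c • x) = c • S.1 x :=
  (isAdjointPair_star S).map_smul c x

variable [StarOrderedRing B]

/-- Cauchy–Schwarz applied to ⟪S x, S x⟫ = ⟪x, S⋆S x⟫ gives ‖S x‖² ≤ ‖S⋆S‖ ‖x‖². -/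
instance : CStarRing (Adjointable B E) where
  norm_mul_self_le S := by
    have h : ‖S.1‖ ≤ √‖(star S * S).1‖ := by
      refine ContinuousLinearMap.opNorm_le_bound _ (Real.sqrt_nonneg _) fun x => ?_
      refine (sq_le_sq₀ (norm_nonneg _) (by positivity)).mp ?_
      rw [mul_pow, Real.sq_sqrt (norm_nonneg _), CStarModule.norm_sq_eq B, inner_left]
      calc _ ≤ ‖x‖ * ‖(star S * S).1 x‖ := CStarModule.norm_inner_le E
        _ ≤ ‖x‖ * (‖(star S * S).1‖ * ‖x‖) := by gcongr; exact (star S * S).1.le_opNorm x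
        _ = _ := by ring
    exact (mul_self_le_mul_self (norm_nonneg S.1) h).trans_eq
      (Real.mul_self_sqrt (norm_nonneg (star S * S).1))

theorem isClosed [CompleteSpace E] : IsClosed (Adjointable B E : Set (E →L[ℂ] E)) := by
  refine IsSeqClosed.isClosed fun u S hu hS => ?_
  let v : ℕ → Adjointable B E := fun n => ⟨u n, hu n⟩
  have hv : CauchySeq v := by
    refine isUniformEmbedding_subtype_val.isUniformInducing.cauchy_map_iff.mp ?_
    rw [map_map]
    exact hS.cauchySeq
  -- The star is isometric, so the adjoints also form a Cauchy sequence; their limit is the adjoint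
  -- of `S`.
  have hsv : CauchySeq fun n => (star (v n)).1 :=
    uniformContinuous_subtype_val.comp_cauchySeq
      ((starₗᵢ ℂ : Adjointable B E ≃ₗᵢ⋆[ℂ] _).isometry.uniformContinuous.comp_cauchySeq hv)
  obtain ⟨T, hT⟩ := cauchySeq_tendsto_of_complete hsv
  refine ⟨T, fun x y => ?_⟩
  have h1 : Tendsto (fun n => ⟪u n x, y⟫_B) atTop (𝓝 ⟪S x, y⟫_B) :=
    (CStarModule.continuous_inner.tendsto (S x, y)).comp
      ((((ContinuousLinearMap.apply ℂ E x).continuous.tendsto S).comp hS).prodMk_nhds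
        tendsto_const_nhds)
  have h2 : Tendsto (fun n => ⟪x, (star (v n)).1 y⟫_B) atTop (𝓝 ⟪x, T y⟫_B) :=
    (CStarModule.continuous_inner.tendsto (x, T y)).comp
      (tendsto_const_nhds.prodMk_nhds
        (((ContinuousLinearMap.apply ℂ E y).continuous.tendsto T).comp hT))
  exact tendsto_nhds_unique h1 (h2.congr fun n => (inner_left (v n) x y).symm)

variable [CompleteSpace E]

instance : CompleteSpace (Adjointable B E) := (isClosed (B := B) (E := E)).completeSpace_coe

noncomputable instance : CStarAlgebra (Adjointable B E) where

noncomputable instance : PartialOrder (Adjointable B E) := CStarAlgebra.spectralOrder _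

instance : StarOrderedRing (Adjointable B E) := CStarAlgebra.spectralOrderedRing _

/-- A self-adjoint operator whose quadratic form is nonnegative is a positive element of the
C⋆-algebra of adjointable operators. -/
theorem nonneg_of_inner_nonneg {P : Adjointable B E} (hP : IsSelfAdjoint P)
    (h : ∀ x, 0 ≤ ⟪x, P.1 x⟫_B) : 0 ≤ P := by
  rw [← CFC.negPart_eq_zero_iff P hP]
  set N : Adjointable B E := P⁻ with hN
  have hN0 : 0 ≤ N := CFC.negPart_nonneg P
  have hNs : star N = N := hN0.isSelfAdjoint
  have hPN : P * N = -(N * N) := by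
    conv_lhs => rw [← CFC.posPart_sub_negPart P hP, sub_mul, CFC.posPart_mul_negPart, zero_sub]
  set Q : Adjointable B E := CFC.sqrt N with hQ
  have hQs : star Q = Q := (CFC.sqrt_nonneg N).isSelfAdjoint
  have hQQ : Q * Q = N := CFC.sqrt_mul_sqrt_self N
  -- At the vector `N x` the form of `P` equals -⟪QNx, QNx⟫, so nonnegativity forces QNx = 0.
  have hz : ∀ x, Q.1 (N.1 x) = 0 := fun x => by
    have h1 := h (N.1 x)
    have h2 : P.1 (N.1 x) = -(Q.1 (Q.1 (N.1 x))) := by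
      have h3 := congrArg (fun S : Adjointable B E => S.1 x) hPN
      have h4 := congrArg (fun S : Adjointable B E => S.1 (N.1 x)) hQQ
      exact h3.trans (congrArg Neg.neg h4.symm)
    rw [h2, CStarModule.inner_neg_right, inner_right, hQs, neg_nonneg] at h1
    exact (CStarModule.inner_self (A := B)).mp (le_antisymm h1 CStarModule.inner_self_nonneg)
  have hNN : star N * N = 0 := by
    rw [hNs]
    refine Subtype.ext <| ContinuousLinearMap.ext fun x => ?_
    have h4 := congrArg (fun S : Adjointable B E => S.1 (N.1 x)) hQQ
    refine h4.symm.trans ?_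
    change Q.1 (Q.1 (N.1 x)) = 0
    rw [hz, map_zero]
  exact (CStarRing.star_mul_self_eq_zero_iff N).mp hNN

end Adjointable

end Adjointable

end RightHilbert

namespace RightHilbert

/-! ### Polar decomposition -/

section Polar

variable {B E F : Type*} [NonUnitalCStarAlgebra B] [PartialOrder B] [StarOrderedRing B]
  [NormedAddCommGroup E] [NormedSpace ℂ E] [SMul B E] [CStarModule B E] [CompleteSpace E]
  [NormedAddCommGroup F] [NormedSpace ℂ F] [SMul B F] [CStarModule B F] [CompleteSpace F]

/-- The polar decomposition: if an adjointable map and its adjoint both have dense range, then the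
two Hilbert C⋆-modules are isomorphic. -/
theorem IsAdjointPair.exists_equiv {T : E →ₗ[ℂ] F} {T' : F →ₗ[ℂ] E} (h : IsAdjointPair B T T')
    (hT : DenseRange T) (hT' : DenseRange T') :
    ∃ U : E ≃ₗ[ℂ] F, (∀ (c : B) (x : E), U (c • x) = c • U x) ∧
      ∀ x y : E, ⟪U x, U y⟫_B = ⟪x, y⟫_B := by
  let P : Adjointable B E := ⟨⟨T' ∘ₗ T, h.symm.continuous.comp h.continuous⟩,
    ⟨T' ∘ₗ T, h.symm.continuous.comp h.continuous⟩,
    fun x y => (h.symm (T x) y).trans (h x (T y))⟩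
  have hPx : ∀ x y, ⟪x, P.1 y⟫_B = ⟪T x, T y⟫_B := fun x y => (h x (T y)).symm
  have hP : 0 ≤ P := Adjointable.nonneg_of_inner_nonneg
    (Adjointable.star_eq_of_isAdjointPair fun x y => (h.symm (T x) y).trans (h x (T y)))
    fun x => by rw [hPx]; exact CStarModule.inner_self_nonneg
  -- `Q` is the modulus |T|, the square root of T'T.
  obtain ⟨Q, hQs, hQQ⟩ : ∃ Q : Adjointable B E, star Q = Q ∧ Q * Q = P :=
    ⟨CFC.sqrt P, (CFC.sqrt_nonneg P).isSelfAdjoint, CFC.sqrt_mul_sqrt_self P⟩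
  have hQQx : ∀ x, Q.1 (Q.1 x) = T' (T x) := fun x =>
    congrArg (fun S : Adjointable B E => S.1 x) hQQ
  have hin : ∀ x y, ⟪Q.1 x, Q.1 y⟫_B = ⟪T x, T y⟫_B := fun x y => by
    rw [Adjointable.inner_left, hQs, hQQx, h]
  have hnorm : ∀ x, ‖Q.1 x‖ = ‖T x‖ := fun x => by
    rw [CStarModule.norm_eq_sqrt_norm_inner_self (A := B), hin,
      ← CStarModule.norm_eq_sqrt_norm_inner_self]
  -- The range of `Q` contains that of Q² = T'T, which is dense.
  have hQ : DenseRange (Q.1 : E →ₗ[ℂ] E) := by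
    refine Dense.mono ?_ (hT'.comp hT h.symm.continuous)
    rintro _ ⟨x, rfl⟩
    exact ⟨Q.1 x, hQQx x⟩
  -- The isometric assignments Qx ↦ Tx and Tx ↦ Qx extend by density to mutually inverse operators.
  let U : E →L[ℂ] F := T.extendOfNorm (Q.1 : E →ₗ[ℂ] E)
  let V : F →L[ℂ] E := (Q.1 : E →ₗ[ℂ] E).extendOfNorm T
  have hU : ∀ x, U (Q.1 x) = T x := fun x =>
    LinearMap.extendOfNorm_eq hQ ⟨1, fun x => by simpa using (hnorm x).ge⟩ x
  have hV : ∀ x, V (T x) = Q.1 x := fun x =>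
    LinearMap.extendOfNorm_eq hT ⟨1, fun x => by simpa using (hnorm x).le⟩ x
  have hVU : ∀ x, V (U x) = x := congrFun <| hQ.equalizer (V.comp U).continuous continuous_id <|
    funext fun x => by simp [hU, hV]
  have hUV : ∀ x, U (V x) = x := congrFun <| hT.equalizer (U.comp V).continuous continuous_id <|
    funext fun x => by simp [hU, hV]
  refine ⟨LinearEquiv.ofLinearMap U.toLinearMap V.toLinearMap (LinearMap.ext hUV) (LinearMap.ext hVU),
    fun c x => ?_, fun x y => ?_⟩
  · change U (c • x) = c • U x
    refine congrFun (hQ.equalizer (g := fun x => U (c • x)) (h := fun x => c • U x)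
      (U.continuous.comp (smulL c).continuous) ((smulL c).continuous.comp U.continuous) ?_) x
    ext x
    change U (c • Q.1 x) = c • U (Q.1 x)
    rw [← Adjointable.map_smul, hU, hU, h.map_smul]
  · change ⟪U x, U y⟫_B = ⟪x, y⟫_B
    refine congrFun ((hQ.prodMap hQ).equalizer (g := fun p : E × E => ⟪U p.1, U p.2⟫_B)
      (h := fun p => ⟪p.1, p.2⟫_B) (CStarModule.continuous_inner.comp
        ((U.continuous.comp continuous_fst).prodMk (U.continuous.comp continuous_snd)))
      CStarModule.continuous_inner ?_) (x, y)
    ext ⟨x, y⟩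
    change ⟪U (Q.1 x), U (Q.1 y)⟫_B = ⟪Q.1 x, Q.1 y⟫_B
    rw [hU, hU, hin]

end Polar

/-! ### Accretive operators and their resolvents -/

namespace Adjointable

variable {B E : Type*} [NonUnitalCStarAlgebra B] [PartialOrder B]
  [NormedAddCommGroup E] [NormedSpace ℂ E] [SMul B E] [CStarModule B E]

/-- An adjointable operator is accretive if its real part is a nonnegative form. -/
def IsAccretive (S : Adjointable B E) : Prop := ∀ x, 0 ≤ ⟪x, S.1 x⟫_B + ⟪S.1 x, x⟫_B

theorem IsAccretive.adjoint {S : Adjointable B E} (hS : IsAccretive S) : IsAccretive (star S) :=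
  fun x => by rw [← inner_left, ← inner_right, add_comm]; exact hS x

variable [StarOrderedRing B]

/-- In the expansion of the right side the cross terms are `t` times the accretive form, hence
nonnegative. -/
theorem IsAccretive.smul_inner_le {S : Adjointable B E} (hS : IsAccretive S) {t : ℝ} (ht : 0 ≤ t)
    (x : E) : (t ^ 2) • ⟪x, x⟫_B ≤ ⟪S.1 x + t • x, S.1 x + t • x⟫_B := by
  have h1 : ⟪S.1 x + t • x, S.1 x + t • x⟫_B =
      (t ^ 2) • ⟪x, x⟫_B + (⟪S.1 x, S.1 x⟫_B + t • (⟪x, S.1 x⟫_B + ⟪S.1 x, x⟫_B)) := by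
    simp only [CStarModule.inner_add_left, CStarModule.inner_add_right,
      CStarModule.inner_smul_left_real, CStarModule.inner_smul_right_real, smul_add, smul_smul, sq]
    abel
  rw [h1]
  exact le_add_of_nonneg_right
    (add_nonneg CStarModule.inner_self_nonneg (smul_nonneg ht (hS x)))

theorem IsAccretive.norm_le {S : Adjointable B E} (hS : IsAccretive S) {t : ℝ} (ht : 0 ≤ t)
    (x : E) : t * ‖x‖ ≤ ‖S.1 x + t • x‖ := by
  refine (sq_le_sq₀ (by positivity) (norm_nonneg _)).mp ?_
  rw [mul_pow, CStarModule.norm_sq_eq B, CStarModule.norm_sq_eq B]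
  have h1 := CStarAlgebra.norm_le_norm_of_nonneg_of_le
    (smul_nonneg (sq_nonneg t) (CStarModule.inner_self_nonneg (A := B))) (hS.smul_inner_le ht x)
  rwa [norm_smul, Real.norm_of_nonneg (sq_nonneg t)] at h1

variable [CompleteSpace E]

theorem IsAccretive.isUnit_star_mul_self {S : Adjointable B E} (hS : IsAccretive S) {t : ℝ}
    (ht : 0 < t) : IsUnit (star (S + t • 1) * (S + t • 1)) := by
  have h0 : IsStrictlyPositive ((t ^ 2) • (1 : Adjointable B E)) :=
    IsStrictlyPositive.smul (by positivity) isStrictlyPositive_one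
  refine CStarAlgebra.isUnit_of_le _ ?_ h0
  rw [← sub_nonneg]
  refine nonneg_of_inner_nonneg ?_ fun x => ?_
  · exact (IsSelfAdjoint.star_mul_self _).sub h0.nonneg.isSelfAdjoint
  · have h1 : ⟪x, (star (S + t • 1) * (S + t • 1) - (t ^ 2) • 1).1 x⟫_B =
        ⟪S.1 x + t • x, S.1 x + t • x⟫_B - (t ^ 2) • ⟪x, x⟫_B := by
      rw [← CStarModule.inner_smul_right_real]
      have h2 := inner_left (S + t • 1) x ((S + t • 1).1 x)
      exact (CStarModule.inner_sub_right).trans (congrArg (· - _) h2.symm)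
    rw [h1, sub_nonneg]
    exact hS.smul_inner_le ht.le x

/-- Put X = S + t. Invertibility of X⋆X gives X a left inverse; that of XX⋆, which comes from
accretivity of the adjoint, gives a right inverse. -/
theorem IsAccretive.isUnit_add_smul {S : Adjointable B E} (hS : IsAccretive S) {t : ℝ}
    (ht : 0 < t) : IsUnit (S + t • 1) := by
  have h1 := hS.isUnit_star_mul_self ht
  have h2 := hS.adjoint.isUnit_star_mul_self ht
  have h3 : star (star S + t • (1 : Adjointable B E)) = S + t • 1 := by
    simp [star_smul]
  have h4 : star S + t • (1 : Adjointable B E) = star (S + t • 1) := by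
    rw [← h3, star_star]
  rw [h3, h4] at h2
  rw [isUnit_iff_exists_and_exists]
  obtain ⟨b, hb, -⟩ := isUnit_iff_exists.mp h2
  obtain ⟨c, -, hc⟩ := isUnit_iff_exists.mp h1
  exact ⟨⟨_, (mul_assoc _ _ _).symm.trans hb⟩, ⟨_, (mul_assoc _ _ _).trans hc⟩⟩

/-- The element `y` is dominated by the real part of `S`. -/
def IsDominated (S : Adjointable B E) (y : E) : Prop :=
  ∃ C : ℝ, 0 ≤ C ∧ ∀ w, ⟪y, w⟫_B * ⟪w, y⟫_B ≤ C • (⟪w, S.1 w⟫_B + ⟪S.1 w, w⟫_B)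

/-- The operators Rₙ are the resolvents (S + dₙ)⁻¹ with dₙ → 0, for which S Rₙ y - y = -dₙ Rₙ y.
Accretivity bounds this by ‖y‖; domination of y improves the bound to order √dₙ. -/
theorem IsAccretive.exists_approx {S : Adjointable B E} (hS : IsAccretive S) :
    ∃ R : ℕ → Adjointable B E, (∀ n y, ‖S.1 ((R n).1 y) - y‖ ≤ ‖y‖) ∧
      ∀ y, IsDominated S y → Tendsto (fun n => S.1 ((R n).1 y)) atTop (𝓝 y) := by
  let d : ℕ → ℝ := fun n => 1 / ((n : ℝ) + 1)
  have hd : ∀ n, 0 < d n := fun n => Nat.one_div_pos_of_nat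
  have hdlim : Tendsto d atTop (𝓝 0) := tendsto_one_div_add_atTop_nhds_zero_nat
  choose R hR hR' using fun n => isUnit_iff_exists.mp (hS.isUnit_add_smul (hd n))
  have hRy : ∀ n y, S.1 ((R n).1 y) + d n • (R n).1 y = y := fun n y =>
    congrArg (fun S : Adjointable B E => S.1 y) (hR n)
  have hRs : ∀ n y, (star S).1 ((star (R n)).1 y) + d n • (star (R n)).1 y = y := fun n y => by
    have h1 := congrArg (fun S : Adjointable B E => (star S).1 y) (hR' n)
    simp only [star_mul, star_add, star_one, star_smul, star_trivial] at h1
    exact h1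
  have hsub : ∀ n y, S.1 ((R n).1 y) - y = -(d n • (R n).1 y) := fun n y => by
    rw [sub_eq_iff_eq_add]
    nth_rw 3 [← hRy n y]
    abel
  refine ⟨R, fun n y => ?_, fun y hy => ?_⟩
  · rw [hsub, norm_neg, norm_smul, Real.norm_of_nonneg (hd n).le]
    simpa only [hRy] using hS.norm_le (hd n).le ((R n).1 y)
  · obtain ⟨C, hC, hy⟩ := hy
    rw [tendsto_iff_norm_sub_tendsto_zero]
    have key : ∀ n, ‖S.1 ((R n).1 y) - y‖ ^ 2 ≤ 2 * C * d n := by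
      intro n
      rw [hsub, norm_neg, norm_smul, Real.norm_of_nonneg (hd n).le]
      set z := (R n).1 y with hz
      -- This test vector turns ⟪y, w⟫ into ⟪z, z⟫. Domination then gives ‖z‖⁴ ≤ 2C ‖z‖ ‖w‖, and dₙ
      -- ‖w‖ ≤ ‖z‖ yields dₙ ‖z‖² ≤ 2C.
      set w := (star (R n)).1 z with hw
      have hyw : ⟪y, w⟫_B = ⟪z, z⟫_B := by rw [hw, ← inner_left]
      have hwy : ⟪w, y⟫_B = ⟪z, z⟫_B := by rw [hw, ← inner_right]
      have hwn : d n * ‖w‖ ≤ ‖z‖ := by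
        simpa only [hw, hRs] using hS.adjoint.norm_le (hd n).le w
      have h1 : ⟪w, S.1 w⟫_B + ⟪S.1 w, w⟫_B ≤ ⟪z, w⟫_B + ⟪w, z⟫_B := by
        have h2 : z = (star S).1 w + d n • w := (hRs n z).symm
        rw [inner_right S w w, inner_left S w w]
        conv_rhs => rw [h2]
        simp only [CStarModule.inner_add_left, CStarModule.inner_add_right,
          CStarModule.inner_smul_left_real, CStarModule.inner_smul_right_real]
        have h3 : 0 ≤ d n • ⟪w, w⟫_B := smul_nonneg (hd n).le CStarModule.inner_self_nonneg
        exact add_le_add (le_add_of_nonneg_right h3) (le_add_of_nonneg_right h3)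
      have h2 : ⟪z, z⟫_B * star ⟪z, z⟫_B ≤ C • (⟪z, w⟫_B + ⟪w, z⟫_B) := by
        have h3 := (hy w).trans (smul_le_smul_of_nonneg_left h1 hC)
        rw [hyw, hwy] at h3
        rwa [CStarModule.star_inner]
      have h3 := CStarAlgebra.norm_le_norm_of_nonneg_of_le (mul_star_self_nonneg _) h2
      rw [CStarRing.norm_self_mul_star, ← CStarModule.norm_sq_eq B, norm_smul,
        Real.norm_of_nonneg hC] at h3
      have h4 : ‖⟪z, w⟫_B + ⟪w, z⟫_B‖ ≤ 2 * (‖z‖ * ‖w‖) := by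
        refine (norm_add_le _ _).trans ?_
        have h5 := CStarModule.norm_inner_le E (A := B) (x := z) (y := w)
        have h6 := CStarModule.norm_inner_le E (A := B) (x := w) (y := z)
        linarith
      have h5 : ‖z‖ ^ 2 * ‖z‖ ^ 2 * d n ≤ 2 * C * ‖z‖ ^ 2 := by
        calc _ ≤ C * (2 * (‖z‖ * ‖w‖)) * d n := by
              exact mul_le_mul_of_nonneg_right
                (h3.trans (mul_le_mul_of_nonneg_left h4 hC)) (hd n).le
          _ = 2 * C * ‖z‖ * (d n * ‖w‖) := by ring
          _ ≤ 2 * C * ‖z‖ * ‖z‖ := by gcongr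
          _ = _ := by ring
      rcases (sq_nonneg ‖z‖).eq_or_lt with h6 | h6
      · rw [mul_pow, ← h6, mul_zero]
        have := hd n
        positivity
      · have h7 : ‖z‖ ^ 2 * d n ≤ 2 * C := by
          refine le_of_mul_le_mul_right ?_ h6
          linarith
        calc _ = ‖z‖ ^ 2 * d n * d n := by ring
          _ ≤ _ := mul_le_mul_of_nonneg_right h7 (hd n).le
    have h1 : Tendsto (fun n => ‖S.1 ((R n).1 y) - y‖ ^ 2) atTop (𝓝 0) :=
      squeeze_zero (fun _ => sq_nonneg _) key (by simpa using hdlim.const_mul (2 * C))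
    simpa using h1.sqrt

/-- An accretive operator has dense range in the part of an invariant subset that lies in the closed
submodule generated by the elements dominated by its real part. -/
theorem IsAccretive.mem_closure_image {S : Adjointable B E} (hS : IsAccretive S) {V : Set E}
    (hV : ∀ (R : Adjointable B E), ∀ v ∈ V, R.1 v ∈ V) {y : E} (hyV : y ∈ V)
    (hy : y ∈ (Submodule.span ℂ {x : E | ∃ (c : B) (d : E), IsDominated S d ∧
      x = c • d}).topologicalClosure) : y ∈ closure (S.1 '' V) := by
  obtain ⟨R, hR1, hR2⟩ := hS.exists_approx
  suffices h : Tendsto (fun n => S.1 ((R n).1 y)) atTop (𝓝 y) from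
    mem_closure_of_tendsto h (Eventually.of_forall fun n => ⟨_, hV (R n) y hyV, rfl⟩)
  have hspan : ∀ z ∈ Submodule.span ℂ {x : E | ∃ (c : B) (d : E), IsDominated S d ∧ x = c • d},
      Tendsto (fun n => S.1 ((R n).1 z)) atTop (𝓝 z) := by
    intro z hz
    induction hz using Submodule.span_induction with
    | mem z hz =>
      obtain ⟨c, d, hd, rfl⟩ := hz
      simp only [map_smul]
      exact ((smulL c : E →L[ℂ] E).continuous.tendsto d).comp (hR2 d hd)
    | zero => simp
    | add z w _ _ h1 h2 => simpa using h1.add h2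
    | smul r z _ h1 => simpa using h1.const_smul r
  -- The errors S Rₙ - 1 are bounded by 1 uniformly in n, so convergence passes from the span to its
  -- closure.
  rw [Metric.tendsto_atTop]
  intro e he
  obtain ⟨z, hz, hyz⟩ := Metric.mem_closure_iff.mp hy (e / 3) (by positivity)
  obtain ⟨N, hN⟩ := Metric.tendsto_atTop.mp (hspan z hz) (e / 3) (by positivity)
  refine ⟨N, fun n hn => ?_⟩
  have h1 := hN n hn
  have h2 := hR1 n (y - z)
  rw [dist_eq_norm] at h1 hyz ⊢
  have h3 : S.1 ((R n).1 y) - y =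
      (S.1 ((R n).1 (y - z)) - (y - z)) + (S.1 ((R n).1 z) - z) := by
    simp only [map_sub]
    abel
  rw [h3]
  refine (norm_add_le _ _).trans_lt ?_
  linarith

end Adjointable

end RightHilbert

namespace RightHilbert

section Basic

variable {B E : Type*} [NonUnitalCStarAlgebra B] [PartialOrder B]
  [NormedAddCommGroup E] [NormedSpace ℂ E] [SMul B E] [CStarModule B E]

theorem add_smul' (c d : B) (x : E) : (c + d) • x = c • x + d • x :=
  ext_inner (B := B) fun z => by simp [add_mul]

theorem smul_assoc' (r : ℂ) (c : B) (x : E) : (r • c) • x = r • (c • x) :=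
  ext_inner (B := B) fun z => by simp [smul_mul_assoc]

end Basic

namespace Adjointable

/-! ### Rank one operators and their weighted sums -/

section RankOne

variable {B E : Type*} [NonUnitalCStarAlgebra B] [PartialOrder B] [StarOrderedRing B]
  [NormedAddCommGroup E] [NormedSpace ℂ E] [SMul B E] [CStarModule B E]

theorem norm_inner_smul_le (x h : E) : ‖⟪x, h⟫_B • x‖ ≤ ‖x‖ * ‖x‖ * ‖h‖ := by
  refine (norm_smul_le' _ _).trans ?_
  calc _ ≤ ‖x‖ * ‖h‖ * ‖x‖ := by gcongr; exact CStarModule.norm_inner_le E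
    _ = _ := by ring

variable (B) in
/-- The rank one operator `h ↦ ⟪x, h⟫ • x`. -/
noncomputable def rankOneL (x : E) : E →L[ℂ] E :=
  LinearMap.mkContinuous
    { toFun := fun h => ⟪x, h⟫_B • x
      map_add' := fun h k => by rw [CStarModule.inner_add_right, add_smul']
      map_smul' := fun r h => by
        rw [CStarModule.inner_smul_right_complex, smul_assoc', RingHom.id_apply] }
    (‖x‖ * ‖x‖) (norm_inner_smul_le x)

theorem isAdjointPair_rankOneL (x : E) : IsAdjointPair B (rankOneL B x) (rankOneL B x) :=
  fun h k => by
    change ⟪⟪x, h⟫_B • x, k⟫_B = ⟪h, ⟪x, k⟫_B • x⟫_B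
    simp

variable (B) in
/-- The rank one operator `h ↦ ⟪x, h⟫ • x`, as an adjointable operator. -/
noncomputable def rankOne (x : E) : Adjointable B E :=
  ⟨rankOneL B x, rankOneL B x, isAdjointPair_rankOneL x⟩

theorem star_rankOne (x : E) : star (rankOne B x) = rankOne B x :=
  star_eq_of_isAdjointPair (isAdjointPair_rankOneL x)

theorem norm_rankOne_le (x : E) : ‖rankOne B x‖ ≤ ‖x‖ * ‖x‖ :=
  ContinuousLinearMap.opNorm_le_bound _ (by positivity) (norm_inner_smul_le x)

theorem inner_mul_inner_nonneg (x w : E) : 0 ≤ ⟪x, w⟫_B * ⟪w, x⟫_B := by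
  rw [← CStarModule.star_inner x w]
  exact mul_star_self_nonneg _

variable [CompleteSpace E]

/-- For a sequence in a Hilbert C⋆-module there is a positive operator that dominates the rank one
operators of its members, and whose range is in the closed submodule they generate. -/
theorem exists_dominating (x : ℕ → E) : ∃ a : Adjointable B E, star a = a ∧
    (∀ w, 0 ≤ ⟪w, a.1 w⟫_B) ∧
    (∀ n, ∃ C : ℝ, 0 ≤ C ∧ ∀ w, ⟪x n, w⟫_B * ⟪w, x n⟫_B ≤ C • ⟪w, a.1 w⟫_B) ∧
    ∀ V : Submodule ℂ E, IsClosed (V : Set E) → (∀ n (c : B), c • x n ∈ V) → ∀ h, a.1 h ∈ V := by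
  -- Since the rank one operator of x has norm at most ‖x‖², these weights make the series converge
  -- absolutely.
  let d : ℕ → ℝ := fun n => (1 / 2) ^ n / (1 + ‖x n‖ * ‖x n‖)
  have hd : ∀ n, 0 < d n := fun n => by positivity
  let f : ℕ → Adjointable B E := fun n => d n • rankOne B (x n)
  have hf : Summable f := by
    refine Summable.of_norm_bounded summable_geometric_two fun n => ?_
    rw [norm_smul, Real.norm_of_nonneg (hd n).le]
    calc d n * ‖rankOne B (x n)‖ ≤ d n * (1 + ‖x n‖ * ‖x n‖) := by
          have := (hd n).le
          gcongr
          exact (norm_rankOne_le (x n)).trans (by linarith)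
      _ = (1 / 2) ^ n := div_mul_cancel₀ _ (by positivity)
  obtain ⟨a, ha⟩ := hf
  have hfs : ∀ n, star (f n) = f n := fun n => by
    simp [f, star_smul, star_rankOne]
  have hah : ∀ h, HasSum (fun n => d n • (⟪x n, h⟫_B • x n)) (a.1 h) := fun h =>
    ha.map ((ContinuousLinearMap.apply ℂ E h).toLinearMap.toAddMonoidHom.comp
      (Adjointable B E).subtype.toAddMonoidHom)
      ((ContinuousLinearMap.apply ℂ E h).continuous.comp continuous_subtype_val)
  have hin : ∀ w, HasSum (fun n => d n • (⟪x n, w⟫_B * ⟪w, x n⟫_B)) ⟪w, a.1 w⟫_B := fun w => by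
    have h1 := (hah w).map (CStarModule.innerSL (A := B) w) (CStarModule.innerSL w).continuous
    refine h1.congr_fun fun n => ?_
    change _ = ⟪w, d n • (⟪x n, w⟫_B • x n)⟫_B
    simp
  have hnn : ∀ w n, 0 ≤ d n • (⟪x n, w⟫_B * ⟪w, x n⟫_B) := fun w n =>
    smul_nonneg (hd n).le (inner_mul_inner_nonneg _ _)
  -- The constant is (d n)⁻¹: the n-th term of a series of nonnegative terms is at most its sum.
  refine ⟨a, ?_, fun w => (hin w).nonneg (hnn w), fun n => ⟨(d n)⁻¹, (inv_pos.mpr (hd n)).le,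
    fun w => ?_⟩, fun V hV hx h => ?_⟩
  · refine HasSum.unique ?_ ha
    simpa only [hfs] using ha.star
  · rw [le_inv_smul_iff_of_pos (hd n)]
    exact le_hasSum (hin w) n fun m _ => hnn w m
  · refine hV.mem_of_tendsto (hah h) (Eventually.of_forall fun s => V.sum_mem fun n _ => ?_)
    exact V.smul_of_tower_mem (d n) (hx n _)

end RankOne

section Perturbation

variable {B E : Type*} [NonUnitalCStarAlgebra B] [PartialOrder B]
  [NormedAddCommGroup E] [NormedSpace ℂ E] [SMul B E] [CStarModule B E]

/-- For imaginary z the operator z b is skew-adjoint and drops out of the real part. -/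
theorem inner_add_inner_add_smul {a b : Adjointable B E} (ha : star a = a) (hb : star b = b)
    {z : ℂ} (hz : star z = -z) (w : E) :
    ⟪w, (a + z • b).1 w⟫_B + ⟪(a + z • b).1 w, w⟫_B = (2 : ℝ) • ⟪w, a.1 w⟫_B := by
  have h1 : (a + z • b).1 w = a.1 w + z • b.1 w := rfl
  rw [h1, CStarModule.inner_add_left, CStarModule.inner_add_right,
    CStarModule.inner_smul_left_complex, CStarModule.inner_smul_right_complex, inner_left, ha,
    inner_left, hb, hz, neg_smul, two_smul]
  abel

end Perturbation

end Adjointable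

/-! ### The submodules HI -/

section Ideal

variable {A : Type*} [NonUnitalCStarAlgebra A]
variable {H : Type*} [NormedAddCommGroup H] [NormedSpace ℂ H] [SMul Aᵐᵒᵖ H]

theorem smul_mem_idealSubmodule_of_mem {I : TwoSidedIdeal A} (h : H) {i : A} (hi : i ∈ I) :
    h <• i ∈ idealSubmodule H I :=
  Submodule.le_topologicalClosure _ (Submodule.subset_span ⟨h, i, hi, rfl⟩)

theorem idealSubmodule_le {I : TwoSidedIdeal A} {V : Submodule ℂ H} (hV : IsClosed (V : Set H))
    (h : ∀ (x : H), ∀ i ∈ I, x <• i ∈ V) : idealSubmodule H I ≤ V :=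
  Submodule.topologicalClosure_minimal _
    (Submodule.span_le.mpr fun _ ⟨x, i, hi, hx⟩ => hx ▸ h x i hi) hV

theorem isClosed_idealSubmodule (I : TwoSidedIdeal A) :
    IsClosed (idealSubmodule H I : Set H) :=
  Submodule.isClosed_topologicalClosure _

theorem idealSubmodule_mono {I J : TwoSidedIdeal A} (h : I ≤ J) :
    idealSubmodule H I ≤ idealSubmodule H J :=
  idealSubmodule_le (isClosed_idealSubmodule J) fun x _ hi => smul_mem_idealSubmodule_of_mem x (h hi)

variable [PartialOrder A] [CStarModule Aᵐᵒᵖ H]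

theorem Adjointable.map_mem_idealSubmodule (I : TwoSidedIdeal A) (S : Adjointable Aᵐᵒᵖ H) {x : H}
    (hx : x ∈ idealSubmodule H I) : S.1 x ∈ idealSubmodule H I := by
  have h := idealSubmodule_le (I := I)
    (V := (idealSubmodule H I).comap S.1.toLinearMap)
    ((isClosed_idealSubmodule I).preimage S.1.continuous) fun x i hi => by
      change S.1 (x <• i) ∈ idealSubmodule H I
      rw [Adjointable.map_smul]
      exact smul_mem_idealSubmodule_of_mem _ hi
  exact h hx

/-- Elements of `I ⊔ J` are sums i + j, so closedness of the sum ideal plays no role. -/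
theorem idealSubmodule_sup_le (I J : TwoSidedIdeal A) {V : Submodule ℂ H}
    (hV : IsClosed (V : Set H)) (hI : idealSubmodule H I ≤ V) (hJ : idealSubmodule H J ≤ V) :
    idealSubmodule H (I ⊔ J) ≤ V := by
  refine idealSubmodule_le hV fun x k hk => ?_
  obtain ⟨i, hi, j, hj, rfl⟩ := TwoSidedIdeal.mem_sup.mp hk
  rw [op_add, add_smul']
  exact V.add_mem (hI (smul_mem_idealSubmodule_of_mem x hi))
    (hJ (smul_mem_idealSubmodule_of_mem x hj))

/-- If `H` is countably generated and `I` is `σ`-unital, then `HI` is countably generated. -/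
theorem exists_generators {I : TwoSidedIdeal A} (hI : IsSigmaUnital I)
    (hH : CountablyGenerated (A := A) H) : ∃ x : ℕ → H, (∀ n, x n ∈ idealSubmodule H I) ∧
      idealSubmodule H I ≤
        (Submodule.span ℂ {y : H | ∃ (c : Aᵐᵒᵖ) (n : ℕ), y = c • x n}).topologicalClosure := by
  obtain ⟨u, hu, hlim⟩ := hI
  obtain ⟨g, hg⟩ := hH
  -- The generators are the products of all gₙ with all uₘ, enumerated by pairing; gₙ i is the limit
  -- of gₙ uₘ i.
  let x : ℕ → H := fun n => g n.unpair.1 <• u n.unpair.2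
  refine ⟨x, fun n => smul_mem_idealSubmodule_of_mem _ (hu _).1, ?_⟩
  set V := (Submodule.span ℂ {y : H | ∃ (c : Aᵐᵒᵖ) (n : ℕ), y = c • x n}).topologicalClosure
    with hV
  have hVc : IsClosed (V : Set H) := Submodule.isClosed_topologicalClosure _
  have hgV : ∀ n, ∀ i ∈ I, g n <• i ∈ V := fun n i hi => by
    have h1 : Tendsto (fun m => op (u m * i) • g n) atTop (𝓝 (op i • g n)) := by
      rw [tendsto_iff_norm_sub_tendsto_zero]
      have h2 := tendsto_iff_norm_sub_tendsto_zero.mp (hlim i hi).1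
      refine squeeze_zero (fun _ => norm_nonneg _) (fun m => ?_)
        (by simpa using h2.mul_const ‖g n‖)
      rw [← sub_smul', ← op_sub]
      exact norm_smul_le' _ _
    refine hVc.mem_of_tendsto h1 (Eventually.of_forall fun m => ?_)
    refine Submodule.le_topologicalClosure _ (Submodule.subset_span ⟨op i, Nat.pair n m, ?_⟩)
    simp [x, mul_smul']
  refine idealSubmodule_le hVc fun h i hi => ?_
  have hcl : IsClosed {h : H | h <• i ∈ V} :=
    hVc.preimage (smulL (op i) : H →L[ℂ] H).continuous
  have hsub : (Submodule.span ℂ {x : H | ∃ (n : ℕ) (a : A), x = g n <• a}) ≤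
      V.comap (smulL (op i) : H →L[ℂ] H).toLinearMap := by
    rw [Submodule.span_le]
    rintro _ ⟨n, a, rfl⟩
    change op i • (op a • g n) ∈ V
    rw [← mul_smul', ← op_mul]
    exact hgV n _ (I.mul_mem_left _ _ hi)
  exact closure_minimal hsub hcl (hg h)

variable [StarOrderedRing A]

/-- The factor b of x = b • y lies in the closed one-sided ideal generated by ⟪x, x⟫, which is
contained in both `I` and `J`; so the same factorization serves both. -/
theorem mem_idealSubmodule_inf [CompleteSpace H] {I J : TwoSidedIdeal A}
    (hI : IsClosed (I : Set A)) (hJ : IsClosed (J : Set A)) {x : H}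
    (hxI : x ∈ idealSubmodule H I) (hxJ : x ∈ idealSubmodule H J) :
    x ∈ idealSubmodule H (I ⊓ J) := by
  obtain ⟨b, y, hb, rfl⟩ := exists_factor (B := Aᵐᵒᵖ) x
  have key : ∀ K : TwoSidedIdeal A, IsClosed (K : Set A) → b • y ∈ idealSubmodule H K →
      unop b ∈ K := fun K hK hx => by
    have hcl : IsClosed {c : Aᵐᵒᵖ | unop c ∈ K} := hK.preimage continuous_unop
    refine closure_minimal ?_ hcl hb
    rintro _ ⟨c, rfl⟩
    exact K.mul_mem_left _ _ (inner_mem_of_mem hK hx _)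
  exact smul_mem_idealSubmodule_of_mem y ⟨key I hI hxI, key J hJ hxJ⟩

/-- For `σ`-unital `I` and countably generated `H` there is a self-adjoint operator with range in
`HI` such that it, perturbed by a skew-adjoint operator, has dense range in the part of any
invariant set that lies in `HI`. -/
theorem exists_operator [CompleteSpace H] {I : TwoSidedIdeal A} (hI : IsSigmaUnital I)
    (hH : CountablyGenerated (A := A) H) : ∃ a : Adjointable Aᵐᵒᵖ H, star a = a ∧
      (∀ h, a.1 h ∈ idealSubmodule H I) ∧
      ∀ b : Adjointable Aᵐᵒᵖ H, star b = b → ∀ z : ℂ, star z = -z → ∀ K : TwoSidedIdeal A,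
        ∀ y ∈ idealSubmodule H K, y ∈ idealSubmodule H I →
          y ∈ closure ((fun v => a.1 v + z • b.1 v) '' (idealSubmodule H K : Set H)) := by
  obtain ⟨x, hxI, hx⟩ := exists_generators hI hH
  obtain ⟨a, ha, hpos, hdom, hran⟩ := Adjointable.exists_dominating (B := Aᵐᵒᵖ) x
  refine ⟨a, ha, hran _ (isClosed_idealSubmodule I) fun n c => smul_mem_idealSubmodule I c (hxI n),
    fun b hb z hz K y hyK hyI => ?_⟩
  have hS : Adjointable.IsAccretive (a + z • b) := fun w => by
    rw [Adjointable.inner_add_inner_add_smul ha hb hz]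
    exact smul_nonneg zero_le_two (hpos w)
  refine hS.mem_closure_image (fun R v hv => Adjointable.map_mem_idealSubmodule K R hv) hyK ?_
  refine Submodule.topologicalClosure_mono (Submodule.span_mono ?_) (hx hyI)
  rintro _ ⟨c, n, rfl⟩
  obtain ⟨C, hC, hCw⟩ := hdom n
  -- The real part form of a + z b is twice that of `a`, hence the halved constant.
  refine ⟨c, x n, ⟨C / 2, by positivity, fun w => ?_⟩, rfl⟩
  rw [Adjointable.inner_add_inner_add_smul ha hb hz, smul_smul, div_mul_cancel₀ _ two_ne_zero]
  exact hCw w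

end Ideal

end RightHilbert

namespace RightHilbert

/-! ### The operator matrix and its diagonalization -/

section Rotation

variable {H : Type*} [NormedAddCommGroup H] [NormedSpace ℂ H]

/-- The operator matrix with rows `(a, b)` and `(-b, a)`. -/
def rotation (a b : H →L[ℂ] H) : H × H →L[ℂ] H × H :=
  (a.comp (.fst ℂ H H) + b.comp (.snd ℂ H H)).prod (a.comp (.snd ℂ H H) - b.comp (.fst ℂ H H))

/-- The closure of the range of `rotation a b` on `p × q`. -/
def rotationRange (a b : H →L[ℂ] H) (p q : Submodule ℂ H) : Submodule ℂ (H × H) :=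
  ((p.prod q).map (rotation a b).toLinearMap).topologicalClosure

variable {a b : H →L[ℂ] H} {p q l : Submodule ℂ H}

theorem isClosed_rotationRange : IsClosed (rotationRange a b p q : Set (H × H)) :=
  Submodule.isClosed_topologicalClosure _

theorem mem_rotationRange {x y : H} (hx : x ∈ p) (hy : y ∈ q) :
    (a x + b y, a y - b x) ∈ rotationRange a b p q :=
  Submodule.le_topologicalClosure _ ⟨(x, y), ⟨hx, hy⟩, rfl⟩

theorem mem_of_mem_closure {N : Submodule ℂ (H × H)} (hN : IsClosed (N : Set (H × H)))
    {f : H → H × H} (hf : Continuous f) {s : Set H} (h : ∀ x ∈ s, f x ∈ N) {y : H}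
    (hy : y ∈ closure s) : f y ∈ N := by
  have h1 := map_mem_closure hf hy (t := N) fun x hx => h x hx
  rwa [hN.closure_eq] at h1

/-- The diagonalization of a rotation over the complex numbers. -/
theorem prod_mem_rotationRange (hp : l ≤ p) (hq : l ≤ q)
    (h : ∀ z : ℂ, star z = -z → ∀ y ∈ l, y ∈ closure ((fun v => a v + z • b v) '' (l : Set H)))
    {y : H} (hy : y ∈ l) :
    (y, (0 : H)) ∈ rotationRange a b p q ∧ ((0 : H), y) ∈ rotationRange a b p q := by
  have key : ∀ z : ℂ, star z = -z → z * z = -1 → (y, z • y) ∈ rotationRange a b p q := by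
    intro z hz hzz
    refine mem_of_mem_closure isClosed_rotationRange (f := fun y => (y, z • y)) (by fun_prop) ?_
      (h z hz y hy)
    rintro _ ⟨v, hv, rfl⟩
    -- As z² = -1, the matrix sends (v, zv) to (u, zu) with u = av + z bv.
    have h1 := mem_rotationRange (a := a) (b := b) (hp hv) (hq (l.smul_mem z hv))
    convert h1 using 2
    · simp
    · simp only [map_smul, smul_add, smul_smul, hzz]
      module
  have h1 := key Complex.I (by simp) Complex.I_mul_I
  have h2 := key (-Complex.I) (by simp) (by simp)
  have h3 : (y, (0 : H)) ∈ rotationRange a b p q := by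
    have h4 := Submodule.smul_mem _ (2⁻¹ : ℂ) (Submodule.add_mem _ h1 h2)
    convert h4 using 1
    ext
    · simp only [Prod.smul_fst, Prod.fst_add]
      module
    · simp only [Prod.smul_snd, Prod.snd_add]
      module
  refine ⟨h3, ?_⟩
  have h4 := Submodule.smul_mem _ (-Complex.I) (Submodule.sub_mem _ h1 h3)
  convert h4 using 1
  ext
  · simp
  · simp [smul_smul]

end Rotation

/-! ### The matrix as a map between direct sums -/

section Main

variable {A : Type*} [NonUnitalCStarAlgebra A]
variable {H : Type*} [NormedAddCommGroup H] [NormedSpace ℂ H] [SMul Aᵐᵒᵖ H]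

/-- The restriction of `rotation a b` to an operator between direct sums of submodules `HK`. -/
noncomputable def rotationMap (a b : H →L[ℂ] H) {I J K L : TwoSidedIdeal A}
    (h : ∀ x ∈ idealSubmodule H I, ∀ y ∈ idealSubmodule H J,
      a x + b y ∈ idealSubmodule H K ∧ a y - b x ∈ idealSubmodule H L) :
    C⋆ᵐᵒᵈ(Aᵐᵒᵖ, idealSubmodule H I × idealSubmodule H J) →ₗ[ℂ]
      C⋆ᵐᵒᵈ(Aᵐᵒᵖ, idealSubmodule H K × idealSubmodule H L) where
  toFun x := (WithCStarModule.equiv _ _).symm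
    (⟨a x.1 + b x.2, (h _ x.1.2 _ x.2.2).1⟩, ⟨a x.2 - b x.1, (h _ x.1.2 _ x.2.2).2⟩)
  map_add' x y := by
    refine (WithCStarModule.equiv _ _).injective (Prod.ext (Subtype.ext ?_) (Subtype.ext ?_))
    · change a (x.1 + y.1 : H) + b (x.2 + y.2 : H) = (a x.1 + b x.2) + (a y.1 + b y.2)
      simp only [map_add]
      abel
    · change a (x.2 + y.2 : H) - b (x.1 + y.1 : H) = (a x.2 - b x.1) + (a y.2 - b y.1)
      simp only [map_add]
      abel
  map_smul' r x := by
    refine (WithCStarModule.equiv _ _).injective (Prod.ext (Subtype.ext ?_) (Subtype.ext ?_))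
    · change a (r • x.1 : H) + b (r • x.2 : H) = r • (a x.1 + b x.2)
      simp
    · change a (r • x.2 : H) - b (r • x.1 : H) = r • (a x.2 - b x.1)
      simp [smul_sub]

/-- Density can be tested in H × H: the norm of the direct sum of Hilbert modules differs from the
product norm but defines the same topology. -/
theorem denseRange_rotationMap {a b : H →L[ℂ] H} {I J K L : TwoSidedIdeal A}
    (h : ∀ x ∈ idealSubmodule H I, ∀ y ∈ idealSubmodule H J,
      a x + b y ∈ idealSubmodule H K ∧ a y - b x ∈ idealSubmodule H L)
    (hKL : ∀ x ∈ idealSubmodule H K, ∀ y ∈ idealSubmodule H L,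
      (x, y) ∈ rotationRange a b (idealSubmodule H I) (idealSubmodule H J)) :
    DenseRange (rotationMap a b h) := by
  let e : C⋆ᵐᵒᵈ(Aᵐᵒᵖ, idealSubmodule H K × idealSubmodule H L) → H × H :=
    fun x => ((x.1 : H), (x.2 : H))
  have he : Topology.IsInducing e :=
    (Topology.IsInducing.subtypeVal.prodMap Topology.IsInducing.subtypeVal).comp
      (WithCStarModule.uniformEquiv (A := Aᵐᵒᵖ)
        (E := idealSubmodule H K × idealSubmodule H L)).isUniformInducing.isInducing
  intro x
  rw [he.closure_eq_preimage_closure_image]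
  refine closure_mono ?_ (hKL _ x.1.2 _ x.2.2)
  rintro _ ⟨⟨v, w⟩, ⟨hv, hw⟩, rfl⟩
  exact ⟨_, ⟨(WithCStarModule.equiv _ _).symm (⟨v, hv⟩, ⟨w, hw⟩), rfl⟩, rfl⟩

variable [PartialOrder A] [StarOrderedRing A] [CStarModule Aᵐᵒᵖ H]

theorem isAdjointPair_rotationMap {a b : Adjointable Aᵐᵒᵖ H} (ha : star a = a) (hb : star b = b)
    {I J K L : TwoSidedIdeal A}
    (h : ∀ x ∈ idealSubmodule H I, ∀ y ∈ idealSubmodule H J,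
      a.1 x + b.1 y ∈ idealSubmodule H K ∧ a.1 y - b.1 x ∈ idealSubmodule H L)
    (h' : ∀ x ∈ idealSubmodule H K, ∀ y ∈ idealSubmodule H L,
      a.1 x + (-b).1 y ∈ idealSubmodule H I ∧ a.1 y - (-b).1 x ∈ idealSubmodule H J) :
    IsAdjointPair Aᵐᵒᵖ (rotationMap a.1 b.1 h) (rotationMap a.1 (-b).1 h') := by
  intro x y
  change ⟪a.1 x.1 + b.1 x.2, (y.1 : H)⟫_(Aᵐᵒᵖ) + ⟪a.1 x.2 - b.1 x.1, (y.2 : H)⟫_(Aᵐᵒᵖ) =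
    ⟪(x.1 : H), a.1 y.1 + -b.1 y.2⟫_(Aᵐᵒᵖ) + ⟪(x.2 : H), a.1 y.2 - -b.1 y.1⟫_(Aᵐᵒᵖ)
  simp only [CStarModule.inner_add_left, CStarModule.inner_add_right, CStarModule.inner_sub_left,
    CStarModule.inner_sub_right, CStarModule.inner_neg_right, Adjointable.inner_left, ha, hb]
  abel

end Main

end RightHilbert

theorem mainTheorem6 {A : Type*} [NonUnitalCStarAlgebra A] [PartialOrder A] [StarOrderedRing A]
    (I J : TwoSidedIdeal A) (hI : IsClosed (I : Set A)) (hJ : IsClosed (J : Set A))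
    (hIσ : RightHilbert.IsSigmaUnital I) (hJσ : RightHilbert.IsSigmaUnital J)
    (H : Type*) [NormedAddCommGroup H] [NormedSpace ℂ H] [CompleteSpace H]
    [SMul Aᵐᵒᵖ H] [CStarModule Aᵐᵒᵖ H] (hH : RightHilbert.CountablyGenerated (A := A) H) :
    RightHilbert.Isomorphic A
      C⋆ᵐᵒᵈ(Aᵐᵒᵖ, RightHilbert.idealSubmodule H I × RightHilbert.idealSubmodule H J)
      C⋆ᵐᵒᵈ(Aᵐᵒᵖ, RightHilbert.idealSubmodule H (I ⊔ J) ×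
        RightHilbert.idealSubmodule H (I ⊓ J)) := by
  open RightHilbert in
  obtain ⟨a, ha, haI, haV⟩ := exists_operator hIσ hH
  obtain ⟨b, hb, hbJ, hbV⟩ := exists_operator hJσ hH
  have hcomplete : ∀ K : TwoSidedIdeal A, CompleteSpace (idealSubmodule H K) := fun K =>
    (isClosed_idealSubmodule K).completeSpace_coe
  set HI := idealSubmodule H I with hHI
  set HJ := idealSubmodule H J with hHJ
  set HS := idealSubmodule H (I ⊔ J) with hHS
  set HL := idealSubmodule H (I ⊓ J) with hHL
  have hIS : HI ≤ HS := idealSubmodule_mono le_sup_left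
  have hJS : HJ ≤ HS := idealSubmodule_mono le_sup_right
  have hLI : HL ≤ HI := idealSubmodule_mono inf_le_left
  have hLJ : HL ≤ HJ := idealSubmodule_mono inf_le_right
  -- Adjointable operators preserve HJ, and `a` has range in HI; so it sends HJ into the
  -- intersection.
  have haL : ∀ y ∈ HJ, a.1 y ∈ HL := fun y hy =>
    mem_idealSubmodule_inf hI hJ (haI y) (Adjointable.map_mem_idealSubmodule J a hy)
  have hbL : ∀ x ∈ HI, b.1 x ∈ HL := fun x hx =>
    mem_idealSubmodule_inf hI hJ (Adjointable.map_mem_idealSubmodule I b hx) (hbJ x)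
  have hdiag : ∀ z : ℂ, star z = -z → ∀ y ∈ HL,
      y ∈ closure ((fun v => a.1 v + z • b.1 v) '' (HL : Set H)) := fun z hz y hy =>
    haV b hb z hz _ y hy (hLI hy)
  have hdiag' : ∀ z : ℂ, star z = -z → ∀ y ∈ HL,
      y ∈ closure ((fun v => a.1 v + z • (-b).1 v) '' (HL : Set H)) := fun z hz y hy =>
    haV (-b) (by rw [star_neg, hb]) z hz _ y hy (hLI hy)
  -- With z = 0 the perturbation vanishes: `a` alone has dense range in HI.
  have haI' : ∀ y ∈ HI, y ∈ closure (a.1 '' (HI : Set H)) := fun y hy => by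
    simpa using haV a ha 0 (by simp) _ y hy hy
  have hbJ' : ∀ y ∈ HJ, y ∈ closure (b.1 '' (HJ : Set H)) := fun y hy => by
    simpa using hbV b hb 0 (by simp) _ y hy hy
  have h : ∀ x ∈ HI, ∀ y ∈ HJ, a.1 x + b.1 y ∈ HS ∧ a.1 y - b.1 x ∈ HL := fun x hx y hy =>
    ⟨HS.add_mem (hIS (haI x)) (hJS (hbJ y)), HL.sub_mem (haL y hy) (hbL x hx)⟩
  have h' : ∀ x ∈ HS, ∀ y ∈ HL, a.1 x + (-b).1 y ∈ HI ∧ a.1 y - (-b).1 x ∈ HJ := fun x _ y hy =>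
    ⟨HI.add_mem (haI x) (HI.neg_mem (hLI (hbL y (hLI hy)))),
      HJ.sub_mem (hLJ (haL y (hLJ hy))) (HJ.neg_mem (hbJ x))⟩
  have hT : DenseRange (rotationMap a.1 b.1 h) := by
    refine denseRange_rotationMap h fun x hx y hy => ?_
    set N := rotationRange a.1 b.1 HI HJ with hN
    have hL : ∀ y ∈ HL, (y, (0 : H)) ∈ N ∧ ((0 : H), y) ∈ N := fun y hy =>
      prod_mem_rotationRange hLI hLJ hdiag hy
    have hfst : HS ≤ N.comap (LinearMap.inl ℂ H H) := by
      refine idealSubmodule_sup_le I J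
        (isClosed_rotationRange.preimage (Continuous.prodMk_left 0)) ?_ ?_
      · refine fun y hy => mem_of_mem_closure isClosed_rotationRange
          (f := fun y => (y, 0)) (by fun_prop) ?_ (haI' y hy)
        rintro _ ⟨v, hv, rfl⟩
        -- (av, -bv) is in the range, and bv is in HL, so the second coordinate can be removed.
        have h1 := N.add_mem (mem_rotationRange (a := a.1) (b := b.1) hv HJ.zero_mem)
          (hL _ (hbL v hv)).2
        simpa using h1
      · refine fun y hy => mem_of_mem_closure isClosed_rotationRange
          (f := fun y => (y, 0)) (by fun_prop) ?_ (hbJ' y hy)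
        rintro _ ⟨v, hv, rfl⟩
        have h1 := N.sub_mem (mem_rotationRange (a := a.1) (b := b.1) HI.zero_mem hv)
          (hL _ (haL v hv)).2
        simpa using h1
    simpa using N.add_mem (hfst hx) (hL y hy).2
  have hT' : DenseRange (rotationMap a.1 (-b).1 h') := by
    refine denseRange_rotationMap h' fun x hx y hy => ?_
    set N := rotationRange a.1 (-b).1 HS HL with hN
    have hNc : IsClosed (N : Set (H × H)) := isClosed_rotationRange
    have hL : ∀ y ∈ HL, (y, (0 : H)) ∈ N ∧ ((0 : H), y) ∈ N := fun y hy =>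
      prod_mem_rotationRange (hLI.trans hIS) le_rfl hdiag' hy
    have hmem : ∀ v ∈ HS, (a.1 v, b.1 v) ∈ N := fun v hv => by
      have h1 : (a.1 v + (-b).1 0, a.1 0 - (-b).1 v) ∈ N := mem_rotationRange hv HL.zero_mem
      simpa using h1
    have hfst : (x, (0 : H)) ∈ N := by
      refine mem_of_mem_closure hNc
        (f := fun y => (y, 0)) (by fun_prop) ?_ (haI' x hx)
      rintro _ ⟨v, hv, rfl⟩
      simpa using N.sub_mem (hmem v (hIS hv)) (hL _ (hbL v hv)).2
    have hsnd : ((0 : H), y) ∈ N := by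
      refine mem_of_mem_closure hNc
        (f := fun y => (0, y)) (by fun_prop) ?_ (hbJ' y hy)
      rintro _ ⟨v, hv, rfl⟩
      -- For v in HJ it is av that lies in HL, so the first coordinate of (av, bv) is removed.
      simpa using N.sub_mem (hmem v (hJS hv)) (hL _ (haL v hv)).1
    simpa using N.add_mem hfst hsnd
  obtain ⟨U, hU, hUin⟩ := (isAdjointPair_rotationMap ha hb h h').exists_equiv hT hT'
  exact ⟨U, fun x c => hU (op c) x, hUin⟩
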